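/- Let $m\ge 1$, $n\ge 2$, $\mathcal H=\mathbb C^n$ and $\mathcal H^m=\mathcal H^{\otimes m}$. A state is a positive semidefinite operator $\rho$ on $\mathcal H^m$ with $\operatorname{Tr}\rho=1$. For a permutation $\pi$ of $\{1,\dots,m\}$ let $U_\pi$ be the unitary permuting the tensor factors, so that $U_\pi(X_1\otimes\cdots\otimes X_m)U_\pi^\dagger=X_{\pi(1)}\otimes\cdots\otimes X_{\pi(m)}$; for an operator $\sigma$ on $\mathcal H$ let $\sigma^{(i)}$ be $\sigma$ acting on the $i$-th factor and the identity on the others. Let $\mathcal C_{SSC}$ (symmetric-state consensus) be the set of states $\rho$ with $U_\pi\rho U_\pi^\dagger=\rho$ for all $\pi$. For a sequence of maps $\mathcal E_1,\mathcal E_2,\dots$ on operators put $\rho(t)=\mathcal E_t\circ\cdots\circ\mathcal E_1(\rho_0)$. The sequence achieves SSC if, for every initial state $\rho_0$ and every norm on the operators, the distance of $\rho(t)$ to $\mathcal C_{SSC}$ tends to $0$. For self-adjoint $S$ on $\mathcal H^m$ it achieves $S$-average SSC if it achieves SSC and there is a self-adjoint $\sigma$ on $\mathcal H$ such that, for every state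 $\rho_0$ and every $\ell\in\{1,\dots,m\}$, $$\lim_{t\to\infty}\operatorname{Tr}(\sigma\bar\rho_\ell(t))=\lim_{t\to\infty}\operatorname{Tr}(\sigma^{(\ell)}\rho(t))=\lim_{t\to\infty}\operatorname{Tr}(S\rho(t))=\operatorname{Tr}(S\rho_0),$$ where $\bar\rho_\ell(t)$ is the reduced state of subsystem $\ell$. Let $\mathcal G=(V,E)$ be a connected simple graph on $V=\{1,\dots,m\}$, let $\alpha\in(0,1)$, and for an edge $(j,k)$ let $\mathcal E_{j,k}(\rho)=(1-\alpha)\rho+\alpha\,U_{(j,k)}\rho\,U_{(j,k)}^\dagger$, where $U_{(j,k)}$ swaps subsystems $j$ and $k$. For a state $\rho_0$ put $$\rho_*=\frac1{m!}\sum_{\pi}U_\pi\rho_0U_\pi^\dagger .$$ Then $\rho_*\in\mathcal C_{SSC}$, and the following hold. 1. (Cyclic selection.) Let $\mathcal E_t=\mathcal E_{e(t)}$, where the sequence of edges $e$ is periodic and every edge of $\mathcal G$ occurs in it. Then $(\mathcal E_t)$ achieves SSC, and $\rho(t)\to\rho_*$ for every initial state $\rho_0$. 2. (Random selection, in expectation.)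 Let $q_{j,k}>0$, $\sum_{(j,k)\in E}q_{j,k}=1$. The constant sequence $\mathcal E_t=\mathcal E:=\sum_{(j,k)\in E}q_{j,k}\mathcal E_{j,k}$ achieves SSC, and $\mathcal E^t(\rho_0)\to\rho_*$ for every state $\rho_0$. If the edges $e(1),e(2),\dots$ are drawn independently with law $q$ and $\mathcal E_t=\mathcal E_{e(t)}$, then $\mathbb E[\rho(t)]=\mathcal E^t(\rho_0)$ for all $t$, and so $\mathbb E[\rho(t)]\to\rho_*$. 3. (Random selection, trajectories.) Let $e(1),e(2),\dots$ be independent with law $q$ as in 2. With probability one, the sequence $\mathcal E_t=\mathcal E_{e(t)}$ achieves SSC and $\rho(t)\to\rho_*$ for every state $\rho_0$. Moreover, for every state $\rho_0$ and all $\delta,\varepsilon>0$ there is a time $T>0$ with $$\mathbb P\big[\operatorname{Tr}((\rho(T)-\rho_*)^2)>\varepsilon\big]<\delta .$$ 4. (Average consensus.) For the sequence of channels in 1, for the constant sequence $\mathcal E$ in 2, and, with probability one, for the random sequence in 3: for every self-adjoint $S$ on $\mathcal H^m$, $S$-average SSC is achieved if and only if there is a self-adjoint $\sigma$ on $\mathcal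 H$ with $$S=\frac1m\sum_{i=1}^m\sigma^{(i)} .$$ -/

import Mathlib

open scoped ComplexOrder Topology
open Filter MeasureTheory ProbabilityTheory

/-- Operators on the local space `ℂⁿ`. -/
abbrev LocOp (n : ℕ) : Type := Matrix (Fin n) (Fin n) ℂ

/-- Operators on `(ℂⁿ)^{⊗ m}`, written in the product basis, which is indexed by the words
`x : Fin m → Fin n`. -/
abbrev NetOp (m n : ℕ) : Type := Matrix (Fin m → Fin n) (Fin m → Fin n) ℂ

/-- The tensor (Kronecker) product `X₁ ⊗ ⋯ ⊗ X_m`. -/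
def tensorOp {m n : ℕ} (X : Fin m → LocOp n) : NetOp m n :=
  Matrix.of fun x y => ∏ i, X i (x i) (y i)

/-- `σ⁽ⁱ⁾ = I ⊗ ⋯ ⊗ I ⊗ σ ⊗ I ⊗ ⋯ ⊗ I`, with `σ` at position `i`. -/
def localOp {m n : ℕ} (σ : LocOp n) (i : Fin m) : NetOp m n :=
  tensorOp (Function.update (fun _ => (1 : LocOp n)) i σ)

/-- The unitary `U_π` that permutes the subsystems: it maps the basis vector of the word `y` to
that of the word `y ∘ π`; see `permOp_conj_tensorOp` and `permOp_mem_unitary`. -/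
def permOp {m : ℕ} (n : ℕ) (π : Equiv.Perm (Fin m)) : NetOp m n :=
  Matrix.of fun x y => if x = y ∘ π then 1 else 0

/-- Density operators. -/
def IsState {m n : ℕ} (ρ : NetOp m n) : Prop :=
  ρ.PosSemidef ∧ ρ.trace = 1

/-- The set of states in symmetric-state consensus. -/
def SSC (m n : ℕ) : Set (NetOp m n) :=
  {ρ | IsState ρ ∧ ∀ π : Equiv.Perm (Fin m), permOp n π * ρ * (permOp n π).conjTranspose = ρ}

/-- The reduced state of subsystem `k`: the partial trace over all other subsystems. -/
def reducedState {m n : ℕ} (ρ : NetOp m n) (k : Fin m) : LocOp n :=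
  Matrix.of fun a b => ∑ x : Fin m → Fin n, if x k = a then ρ x (Function.update x k b) else 0

/-- `(1 / m!) ∑_π U_π ρ U_π†`. -/
noncomputable def symmetrize {m n : ℕ} (ρ : NetOp m n) : NetOp m n :=
  (1 / (m.factorial : ℂ)) •
    ∑ π : Equiv.Perm (Fin m), permOp n π * ρ * (permOp n π).conjTranspose

/-- The transposition `(j k)` attached to an unordered pair `s(j, k)`. -/
def edgeSwap {m : ℕ} : Sym2 (Fin m) → Equiv.Perm (Fin m) :=
  Sym2.lift ⟨fun j k => Equiv.swap j k, fun j k => Equiv.swap_comm j k⟩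

/-- The gossip channel `ρ ↦ (1 - α) ρ + α U_{(j,k)} ρ U_{(j,k)}†` of the edge `e = s(j, k)`. -/
noncomputable def gossip {m n : ℕ} (α : ℝ) (e : Sym2 (Fin m)) (ρ : NetOp m n) : NetOp m n :=
  (1 - (α : ℂ)) • ρ +
    (α : ℂ) • (permOp n (edgeSwap e) * ρ * (permOp n (edgeSwap e)).conjTranspose)

/-- The state at time `t` when the map `E s` is applied between the times `s` and `s + 1`. -/
def evolve {m n : ℕ} (E : ℕ → NetOp m n → NetOp m n) : ℕ → NetOp m n → NetOp m n
  | 0, ρ => ρ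
  | t + 1, ρ => E t (evolve E t ρ)

/-- The channel `∑_e q_e ℰ_e` of the expected evolution. -/
noncomputable def meanGossip {m n : ℕ} (G : SimpleGraph (Fin m)) [DecidableRel G.Adj] (α : ℝ)
    (q : G.edgeSet → ℝ) (ρ : NetOp m n) : NetOp m n :=
  ∑ e : G.edgeSet, (q e : ℂ) • gossip α (e : Sym2 (Fin m)) ρ

/-- `N` is a norm on the space of operators. -/
def IsOpNorm {m n : ℕ} (N : Seminorm ℂ (NetOp m n)) : Prop :=
  ∀ X, N X = 0 → X = 0

/-- The distance `inf_{τ ∈ C} N (ρ - τ)`. -/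
noncomputable def distTo {m n : ℕ} (N : Seminorm ℂ (NetOp m n)) (ρ : NetOp m n)
    (C : Set (NetOp m n)) : ℝ :=
  sInf ((fun τ => N (ρ - τ)) '' C)

/-- Asymptotic symmetric-state consensus, for the distance of every norm on the
(finite-dimensional) space of operators. -/
def AchievesSSC {m n : ℕ} (E : ℕ → NetOp m n → NetOp m n) : Prop :=
  ∀ N : Seminorm ℂ (NetOp m n), IsOpNorm N → ∀ ρ₀ : NetOp m n, IsState ρ₀ →
    Tendsto (fun t => distTo N (evolve E t ρ₀) (SSC m n)) atTop (𝓝 0)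

/-- Asymptotic `S`-average symmetric-state consensus. -/
def AchievesAverageSSC {m n : ℕ} (E : ℕ → NetOp m n → NetOp m n) (S : NetOp m n) : Prop :=
  AchievesSSC E ∧
  ∃ σ : LocOp n, σ.IsHermitian ∧ ∀ ρ₀ : NetOp m n, IsState ρ₀ → ∀ l : Fin m,
    Tendsto (fun t => (σ * reducedState (evolve E t ρ₀) l).trace) atTop (𝓝 (S * ρ₀).trace) ∧
    Tendsto (fun t => (localOp σ l * evolve E t ρ₀).trace) atTop (𝓝 (S * ρ₀).trace) ∧
    Tendsto (fun t => (S * evolve E t ρ₀).trace) atTop (𝓝 (S * ρ₀).trace)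

/-- `S = (1 / m) ∑_i σ⁽ⁱ⁾` for some local observable `σ`. -/
def IsLocalAverage {m n : ℕ} (S : NetOp m n) : Prop :=
  ∃ σ : LocOp n, σ.IsHermitian ∧ S = (1 / (m : ℂ)) • ∑ i : Fin m, localOp σ i

/-- A selection of edges that periodically cycles through the set of all edges. The order is
arbitrary, and an edge may occur several times in a period. -/
def IsCyclicSelection {m : ℕ} {G : SimpleGraph (Fin m)} (e : ℕ → G.edgeSet) : Prop :=
  (∃ T : ℕ, 0 < T ∧ Function.Periodic e T) ∧ Function.Surjective e

/-- The edges `e 0, e 1, …` are independent random edges with common distribution `q`. -/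
structure IsRandomSelection {m : ℕ} {G : SimpleGraph (Fin m)} (q : G.edgeSet → ℝ)
    {Ω : Type*} [MeasurableSpace Ω] (P : Measure Ω) (e : ℕ → Ω → G.edgeSet) : Prop where
  measurable : ∀ t, Measurable[_, ⊤] (e t)
  indep : iIndepFun (m := fun _ => (⊤ : MeasurableSpace G.edgeSet)) e P
  law : ∀ t a, P {ω | e t ω = a} = ENNReal.ofReal (q a)

/-- The (entrywise) expectation of a random operator. -/
noncomputable def expectedOp {m n : ℕ} {Ω : Type*} [MeasurableSpace Ω] (P : Measure Ω)
    (ρ : Ω → NetOp m n) : NetOp m n :=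
  Matrix.of fun x y => ∫ ω, ρ ω x y ∂P

/-- `U_π (X₁ ⊗ ⋯ ⊗ X_m) U_π† = X_{π(1)} ⊗ ⋯ ⊗ X_{π(m)}`. -/
theorem permOp_conj_tensorOp {m n : ℕ} (π : Equiv.Perm (Fin m)) (X : Fin m → LocOp n) :
    permOp n π * tensorOp X * (permOp n π).conjTranspose = tensorOp (fun i => X (π i)) := by
  have key : ∀ x y : Fin m → Fin n, (x = y ∘ π) ↔ (y = x ∘ π.symm) := by
    intro x y
    constructor
    · rintro rfl
      funext i
      simp
    · rintro rfl
      funext i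
      simp
  ext x y
  simp only [Matrix.mul_apply, permOp, tensorOp, Matrix.of_apply, Matrix.conjTranspose_apply, key]
  simp only [ite_mul, one_mul, zero_mul, Finset.sum_ite_eq', Finset.mem_univ, if_true, apply_ite star,
    star_one, star_zero, mul_ite, mul_one, mul_zero, Function.comp]
  rw [← Equiv.prod_comp π]
  simp

/-- `U_π` is unitary. -/
theorem permOp_mem_unitary {m n : ℕ} (π : Equiv.Perm (Fin m)) :
    permOp n π ∈ Matrix.unitaryGroup (Fin m → Fin n) ℂ := by
  rw [Matrix.mem_unitaryGroup_iff]
  have h1 : (tensorOp (fun _ : Fin m => (1 : LocOp n))) = 1 := by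
    ext x y
    simp only [tensorOp, Matrix.of_apply, Matrix.one_apply, Finset.prod_ite_zero,
      Finset.prod_const_one, Finset.mem_univ, true_imp_iff, funext_iff]
  have h := permOp_conj_tensorOp (n := n) π (fun _ => 1)
  rw [h1, mul_one] at h
  exact h

/-- The defining property of the partial trace: `Tr(σ ρ̄_k) = Tr(σ⁽ᵏ⁾ ρ)`. -/
theorem trace_mul_reducedState {m n : ℕ} (σ : LocOp n) (ρ : NetOp m n) (k : Fin m) :
    (σ * reducedState ρ k).trace = (localOp σ k * ρ).trace := by
  have loc : ∀ x y : Fin m → Fin n, localOp σ k x y =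
      ∑ a, if x = Function.update y k a then σ a (y k) else 0 := by
    intro x y
    rw [localOp, tensorOp, Matrix.of_apply, ← Finset.mul_prod_erase _ _ (Finset.mem_univ k)]
    have h2 : ∏ i ∈ Finset.univ.erase k,
        (Function.update (fun _ => (1 : LocOp n)) k σ) i (x i) (y i)
        = if ∀ i, i ≠ k → x i = y i then 1 else 0 := by
      rw [Finset.prod_congr rfl (g := fun i => if x i = y i then (1 : ℂ) else 0)
        (fun i hi => by rw [Function.update_of_ne (Finset.ne_of_mem_erase hi), Matrix.one_apply])]
      simp [Finset.prod_ite_zero]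
    rw [h2, Function.update_self]
    have h3 : ∀ a, (x = Function.update y k a) ↔ (a = x k ∧ ∀ i, i ≠ k → x i = y i) := by
      intro a
      constructor
      · rintro rfl
        simp +contextual
      · rintro ⟨rfl, h⟩
        funext i
        by_cases hi : i = k
        · subst hi; simp
        · simp [hi, h i hi]
    simp only [h3, ite_and]
    simp
  have rhs : (localOp σ k * ρ).trace =
      ∑ y : Fin m → Fin n, ∑ a, σ a (y k) * ρ y (Function.update y k a) := by
    simp only [Matrix.trace, Matrix.diag, Matrix.mul_apply, loc, Finset.sum_mul]
    rw [Finset.sum_comm]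
    refine Finset.sum_congr rfl fun y _ => ?_
    rw [Finset.sum_comm]
    refine Finset.sum_congr rfl fun a _ => ?_
    simp
  have lhs : (σ * reducedState ρ k).trace =
      ∑ y : Fin m → Fin n, ∑ a, σ a (y k) * ρ y (Function.update y k a) := by
    simp only [Matrix.trace, Matrix.diag, Matrix.mul_apply, reducedState, Matrix.of_apply,
      Finset.mul_sum]
    rw [Finset.sum_comm (s := (Finset.univ : Finset (Fin m → Fin n)))]
    refine Finset.sum_congr rfl fun a _ => ?_
    rw [Finset.sum_comm]
    refine Finset.sum_congr rfl fun y _ => ?_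
    simp
  rw [lhs, rhs]

/-! Conjugation by `U_π` permutes matrix entries, so it is an isometry for the Hilbert-Schmidt norm,
and a gossip channel is a lazy version (1 - α) + αR of a linear contraction R. By strict convexity
such a map strictly decreases the distance to each of its fixed points, unless it fixes the moving
point too. A compactness argument then shows that any product of finitely many such maps, each
occurring infinitely often, converges to a common fixed point (`exists_tendsto_of_paracontracting`).

The common fixed points are the permutation-invariant operators, because the swaps along the edges
of a connected graph generate the symmetric group. Symmetrization is conserved by every channel and
is the identity on invariant operators, so the limit can only be `symmetrize ρ`
(`tendsto_evolve_lazy`).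

Only the recurrence of the edges matters: periodicity gives it in the cyclic case, the second
Borel-Cantelli lemma almost surely in the random case. The mean channel is a single lazy
contraction. Average consensus is then duality: Tr(σ⁽ˡ⁾ρ_*) = Tr(Sρ₀) with S the average of the
σ⁽ⁱ⁾, and states separate operators. -/

/-! ### Paracontractions and lazy contractions. -/

/-- Products of paracontractions with a common fixed point converge to a common fixed point, as
soon as each of the finitely many maps is applied infinitely often. -/
theorem exists_tendsto_of_paracontracting {X ι : Type*} [MetricSpace X] [ProperSpace X] [Finite ι]
    (T : ι → X → X) (hc : ∀ i, Continuous (T i))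
    (hT : ∀ i p x, T i p = p → T i x ≠ x → dist (T i x) p < dist x p)
    {p : X} (hp : ∀ i, T i p = p) (e : ℕ → ι) (he : ∀ i, ∃ᶠ t in atTop, e t = i)
    (x : ℕ → X) (hx : ∀ t, x (t + 1) = T (e t) (x t)) :
    ∃ y, (∀ i, T i y = y) ∧ Tendsto x atTop (𝓝 y) := by
  have step : ∀ i p z, T i p = p → dist (T i z) p ≤ dist z p := by
    intro i p z h
    by_cases hz : T i z = z
    · rw [hz]
    · exact (hT i p z h hz).le
  have anti : ∀ p, (∀ i, T i p = p) → Antitone fun t => dist (x t) p := fun p h =>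
    antitone_nat_of_succ_le fun t => by rw [hx]; exact step _ _ _ (h _)
  obtain ⟨y, -, φ, hφ, hy⟩ := (isCompact_closedBall p (dist (x 0) p)).tendsto_subseq
    (x := x) fun t => anti p hp (Nat.zero_le t)
  set d := dist y p with hd
  have hdle : ∀ t, d ≤ dist (x t) p := fun t => by
    refine le_of_tendsto (hy.dist tendsto_const_nhds) ?_
    filter_upwards [eventually_ge_atTop t] with k hk
    exact anti p hp (hk.trans (hφ.id_le k))
  have hfix : ∀ i, T i y = y := by
    by_contra! hcon
    -- Near `y`, any map that moves `y` would bring the orbit closer to `p` than `d`, which `hdle`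
    -- forbids. Finiteness of the index set makes the neighbourhood uniform.
    have hev : ∀ᶠ z in 𝓝 y, ∀ i, T i y ≠ y → dist (T i z) p < d := by
      rw [eventually_all]
      intro i
      by_cases hi : T i y = y
      · simp [hi]
      · have := ((hc i).tendsto y).dist (tendsto_const_nhds (x := p))
        filter_upwards [this.eventually (gt_mem_nhds (hT i p y (hp i) hi))] with z hz _ using hz
    obtain ⟨ε, hε, hball⟩ := Metric.eventually_nhds_iff.1 hev
    obtain ⟨k, hk⟩ := (hy.eventually (Metric.ball_mem_nhds y hε)).exists
    obtain ⟨i, hi⟩ := hcon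
    have hex : ∃ s, T (e (φ k + s)) y ≠ y := by
      obtain ⟨t, ht, hti⟩ := (frequently_atTop.1 (he i)) (φ k)
      exact ⟨t - φ k, by rw [Nat.add_sub_cancel' ht, hti]; exact hi⟩
    classical
    -- Until the first map that moves `y`, all maps fix `y` and so cannot increase the distance to
    -- it: the orbit is still near `y` when that map acts.
    have hnear : ∀ s ≤ Nat.find hex, dist (x (φ k + s)) y < ε := by
      intro s
      induction s with
      | zero => exact fun _ => hk
      | succ s ih =>
        intro hs
        have h1 : T (e (φ k + s)) y = y := not_not.1 (Nat.find_min hex (Nat.lt_of_succ_le hs))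
        rw [← add_assoc, hx]
        exact (step _ _ _ h1).trans_lt (ih (Nat.le_of_succ_le hs))
    have h2 := hball (hnear _ le_rfl) _ (Nat.find_spec hex)
    rw [← hx] at h2
    exact absurd (hdle _) (not_le.2 h2)
  refine ⟨y, hfix, Metric.tendsto_atTop.2 fun ε hε => ?_⟩
  obtain ⟨k, hk⟩ := (hy.eventually (Metric.ball_mem_nhds y hε)).exists
  exact ⟨φ k, fun t ht => (anti y hfix ht).trans_lt hk⟩

/-- If a convex combination, with positive weights, of vectors of norm at most `‖v‖` is `v`, then
all of these vectors are equal to `v`. -/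
theorem eq_of_sum_smul_eq_of_norm_le {𝕜 E ι : Type*} [RCLike 𝕜] [NormedAddCommGroup E]
    [InnerProductSpace 𝕜 E] [Fintype ι] {q : ι → ℝ} (hq : ∀ i, 0 < q i) (hq1 : ∑ i, q i = 1)
    {v : E} {w : ι → E} (hw : ∀ i, ‖w i‖ ≤ ‖v‖) (h : ∑ i, (q i : 𝕜) • w i = v) (i : ι) :
    w i = v := by
  have hin : ∑ i, q i * RCLike.re (inner 𝕜 v (w i)) = ‖v‖ ^ 2 := by
    rw [← inner_self_eq_norm_sq (𝕜 := 𝕜) v]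
    conv_rhs => rw [← h, inner_sum, h]
    simp [inner_smul_right]
  -- Expand the square and use `‖w i‖ ≤ ‖v‖`. By `hin` the right-hand sides sum to zero.
  have hnn : ∀ i, q i * ‖v - w i‖ ^ 2 ≤
      q i * (2 * ‖v‖ ^ 2) - 2 * (q i * RCLike.re (inner 𝕜 v (w i))) := by
    intro i
    rw [@norm_sub_sq 𝕜]
    have := pow_le_pow_left₀ (norm_nonneg _) (hw i) 2
    nlinarith [hq i]
  have hsum : ∑ i, q i * ‖v - w i‖ ^ 2 ≤ 0 := by
    refine (Finset.sum_le_sum fun i _ => hnn i).trans_eq ?_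
    rw [Finset.sum_sub_distrib, ← Finset.sum_mul, ← Finset.mul_sum, hin, hq1]
    ring
  have h0 : ∀ i ∈ Finset.univ, 0 ≤ q i * ‖v - w i‖ ^ 2 := fun i _ => by
    have := hq i
    positivity
  have := (Finset.sum_eq_zero_iff_of_nonneg h0).1 (le_antisymm hsum (Finset.sum_nonneg h0)) i
    (Finset.mem_univ i)
  have h3 : ‖v - w i‖ = 0 := by simpa [(hq i).ne'] using this
  exact (sub_eq_zero.1 (norm_eq_zero.1 h3)).symm

/-- A lazy version `(1 - α) + α R` of a linear contraction `R` is strictly contracting outside of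
the fixed space of `R`. -/
theorem norm_lazy_lt {𝕜 E : Type*} [RCLike 𝕜] [NormedAddCommGroup E]
    [InnerProductSpace 𝕜 E] {α : ℝ} (hα : α ∈ Set.Ioo (0 : ℝ) 1) {v w : E} (hw : ‖w‖ ≤ ‖v‖)
    (h : w ≠ v) : ‖(1 - (α : 𝕜)) • v + (α : 𝕜) • w‖ < ‖v‖ := by
  have hα0 := hα.1
  have hα1 := hα.2
  -- The defect in the convexity of the squared norm; its last term is the strict gain.
  have key : ‖(1 - (α : 𝕜)) • v + (α : 𝕜) • w‖ ^ 2 =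
      (1 - α) * ‖v‖ ^ 2 + α * ‖w‖ ^ 2 - α * (1 - α) * ‖v - w‖ ^ 2 := by
    rw [@norm_add_sq 𝕜, @norm_sub_sq 𝕜, norm_smul, norm_smul, inner_smul_left, inner_smul_right]
    have h1 : (1 - (α : 𝕜)) = ((1 - α : ℝ) : 𝕜) := by push_cast; rfl
    rw [h1, RCLike.norm_ofReal, RCLike.norm_ofReal, RCLike.conj_ofReal, RCLike.re_ofReal_mul,
      RCLike.re_ofReal_mul, abs_of_pos hα0, abs_of_pos (sub_pos.2 hα1)]
    ring
  have h2 : 0 < ‖v - w‖ := norm_pos_iff.2 (sub_ne_zero.2 h.symm)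
  have h3 := pow_le_pow_left₀ (norm_nonneg _) hw 2
  have h4 : 0 < α * (1 - α) * ‖v - w‖ ^ 2 := by
    have := sub_pos.2 hα1
    positivity
  refine lt_of_pow_lt_pow_left₀ 2 (norm_nonneg _) ?_
  nlinarith

/-- Lazy linear contractions of a Euclidean space, each applied infinitely often. -/
theorem exists_tendsto_of_lazy_contractions {𝕜 E ι : Type*} [RCLike 𝕜] [NormedAddCommGroup E]
    [InnerProductSpace 𝕜 E] [FiniteDimensional 𝕜 E] [Finite ι]
    (R : ι → E →ₗ[𝕜] E) (hR : ∀ i v, ‖R i v‖ ≤ ‖v‖) {α : ℝ} (hα : α ∈ Set.Ioo (0 : ℝ) 1)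
    (e : ℕ → ι) (he : ∀ i, ∃ᶠ t in atTop, e t = i) (x : ℕ → E)
    (hx : ∀ t, x (t + 1) = (1 - (α : 𝕜)) • x t + (α : 𝕜) • R (e t) (x t)) :
    ∃ y, (∀ i, R i y = y) ∧ Tendsto x atTop (𝓝 y) := by
  have : ProperSpace E := FiniteDimensional.proper 𝕜 E
  have hα0 : (α : 𝕜) ≠ 0 := by exact_mod_cast hα.1.ne'
  have hiff : ∀ i v, (1 - (α : 𝕜)) • v + (α : 𝕜) • R i v = v ↔ R i v = v := by
    intro i v
    have : (1 - (α : 𝕜)) • v + (α : 𝕜) • R i v = v + (α : 𝕜) • (R i v - v) := by module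
    rw [this, add_eq_left, smul_eq_zero_iff_right hα0, sub_eq_zero]
  have := exists_tendsto_of_paracontracting
    (fun i v => (1 - (α : 𝕜)) • v + (α : 𝕜) • R i v) (fun i => by
      have := LinearMap.continuous_of_finiteDimensional (R i)
      fun_prop) (fun i p v hp hv => ?_) (p := 0) (by simp) e he x hx
  · simpa only [hiff] using this
  · rw [Ne, hiff] at hv
    have hp' := (hiff i p).1 hp
    rw [dist_eq_norm, dist_eq_norm]
    have h1 : (1 - (α : 𝕜)) • v + (α : 𝕜) • R i v - p =
        (1 - (α : 𝕜)) • (v - p) + (α : 𝕜) • R i (v - p) := by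
      rw [map_sub, hp']; module
    simp only [h1]
    refine norm_lazy_lt hα (hR i _) fun h => hv ?_
    rw [map_sub, hp'] at h
    exact sub_left_injective h

/-! ### Permutation conjugations, symmetrization and its dual. -/

section Symmetrization

variable {m n : ℕ}

/-- The conjugation `X ↦ U_π X U_π†`. -/
noncomputable def permConj (n : ℕ) (π : Equiv.Perm (Fin m)) : NetOp m n →ₗ[ℂ] NetOp m n where
  toFun X := permOp n π * X * (permOp n π).conjTranspose
  map_add' X Y := by rw [mul_add, add_mul]
  map_smul' c X := by simp

theorem permConj_apply (π : Equiv.Perm (Fin m)) (X : NetOp m n) :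
    permConj n π X = permOp n π * X * (permOp n π).conjTranspose := rfl

theorem permConj_apply_apply (π : Equiv.Perm (Fin m)) (X : NetOp m n) (x y : Fin m → Fin n) :
    permConj n π X x y = X (x ∘ π.symm) (y ∘ π.symm) := by
  have key : ∀ x y : Fin m → Fin n, (x = y ∘ π) ↔ (y = x ∘ π.symm) := by
    intro x y
    constructor <;> rintro rfl <;> funext i <;> simp
  simp only [permConj_apply, Matrix.mul_apply, permOp, Matrix.of_apply,
    Matrix.conjTranspose_apply, key]
  simp [apply_ite star]

/-- The order is reversed because relabelling X_i as X_{π(i)} is a right action. Hence absorbing a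
conjugation applied before symmetrizing is a left translation of the group, and one applied after it
a right translation. -/
theorem permConj_mul (π τ : Equiv.Perm (Fin m)) (X : NetOp m n) :
    permConj n (π * τ) X = permConj n τ (permConj n π X) := by
  ext x y
  simp only [permConj_apply_apply]
  rfl

theorem permConj_one (X : NetOp m n) : permConj n 1 X = X := by
  ext x y
  rw [permConj_apply_apply]
  rfl

theorem conjTranspose_permOp (π : Equiv.Perm (Fin m)) :
    (permOp n π).conjTranspose = permOp n π⁻¹ := by
  have key : ∀ x y : Fin m → Fin n, (x = y ∘ π) ↔ (y = x ∘ ⇑π⁻¹) := by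
    intro x y
    constructor <;> rintro rfl <;> funext i <;> simp
  ext x y
  simp only [permOp, Matrix.conjTranspose_apply, Matrix.of_apply, key y x]
  split_ifs <;> simp

theorem trace_mul_permConj (A X : NetOp m n) (π : Equiv.Perm (Fin m)) :
    (A * permConj n π X).trace = (permConj n π⁻¹ A * X).trace := by
  rw [permConj_apply, permConj_apply, ← conjTranspose_permOp, Matrix.conjTranspose_conjTranspose,
    ← mul_assoc, ← mul_assoc, Matrix.trace_mul_comm, ← mul_assoc, ← mul_assoc]

theorem permConj_localOp (σ : LocOp n) (i : Fin m) (π : Equiv.Perm (Fin m)) :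
    permConj n π (localOp σ i) = localOp σ (π⁻¹ i) := by
  rw [permConj_apply, localOp, permOp_conj_tensorOp, localOp]
  congr 1
  funext j
  by_cases h : π j = i
  · subst h; simp
  · have h' : j ≠ π⁻¹ i := fun hj => h (by simp [hj])
    rw [Function.update_of_ne h, Function.update_of_ne h']

theorem symmetrize_eq (X : NetOp m n) :
    symmetrize X = (1 / (m.factorial : ℂ)) • ∑ π : Equiv.Perm (Fin m), permConj n π X := rfl

theorem symmetrize_permConj (π : Equiv.Perm (Fin m)) (X : NetOp m n) :
    symmetrize (permConj n π X) = symmetrize X := by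
  simp only [symmetrize_eq, ← permConj_mul]
  refine congrArg _ ?_
  exact Fintype.sum_equiv (Equiv.mulLeft π) _ _ fun _ => rfl

theorem permConj_symmetrize (π : Equiv.Perm (Fin m)) (X : NetOp m n) :
    permConj n π (symmetrize X) = symmetrize X := by
  simp only [symmetrize_eq, map_smul, map_sum, ← permConj_mul]
  refine congrArg _ ?_
  exact Fintype.sum_equiv (Equiv.mulRight π) _ _ fun _ => rfl

theorem symmetrize_add (X Y : NetOp m n) :
    symmetrize (X + Y) = symmetrize X + symmetrize Y := by
  simp only [symmetrize_eq, map_add, Finset.sum_add_distrib, smul_add]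

theorem symmetrize_smul (c : ℂ) (X : NetOp m n) : symmetrize (c • X) = c • symmetrize X := by
  simp only [symmetrize_eq, map_smul, ← Finset.smul_sum, smul_comm c]

theorem symmetrize_sum {ι : Type*} (s : Finset ι) (X : ι → NetOp m n) :
    symmetrize (∑ i ∈ s, X i) = ∑ i ∈ s, symmetrize (X i) := by
  simp only [symmetrize_eq, map_sum, ← Finset.smul_sum]
  rw [Finset.sum_comm]

theorem symmetrize_of_forall_permConj_eq {X : NetOp m n} (h : ∀ π, permConj n π X = X) :
    symmetrize X = X := by
  have h0 : (m.factorial : ℂ) ≠ 0 := by exact_mod_cast m.factorial_ne_zero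
  rw [symmetrize_eq, Finset.sum_congr rfl fun π _ => h π, Finset.sum_const, Finset.card_univ,
    Fintype.card_perm, Fintype.card_fin, ← Nat.cast_smul_eq_nsmul ℂ, smul_smul, one_div,
    inv_mul_cancel₀ h0, one_smul]

theorem continuous_symmetrize : Continuous (symmetrize : NetOp m n → NetOp m n) := by
  have : Continuous fun X : NetOp m n => ∑ π, permConj n π X := by
    refine continuous_finsetSum _ fun π _ => ?_
    exact (continuous_const.matrix_mul continuous_id).matrix_mul continuous_const
  exact this.const_smul (1 / (m.factorial : ℂ))

theorem trace_permConj (π : Equiv.Perm (Fin m)) (X : NetOp m n) :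
    (permConj n π X).trace = X.trace := by
  have h : (permOp n π).conjTranspose * permOp n π = 1 :=
    (Matrix.mem_unitaryGroup_iff').1 (permOp_mem_unitary π)
  rw [permConj_apply, mul_assoc, Matrix.trace_mul_comm, mul_assoc, h, mul_one]

theorem symmetrize_mem_SSC {ρ : NetOp m n} (hρ : IsState ρ) : symmetrize ρ ∈ SSC m n := by
  have h0 : (m.factorial : ℂ) ≠ 0 := by exact_mod_cast m.factorial_ne_zero
  refine ⟨⟨?_, ?_⟩, fun π => permConj_symmetrize π ρ⟩
  · refine Matrix.PosSemidef.smul (Matrix.posSemidef_sum _ fun π _ => ?_) (by positivity)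
    exact hρ.1.mul_mul_conjTranspose_same _
  · rw [symmetrize_eq, Matrix.trace_smul, Matrix.trace_sum]
    simp [trace_permConj, hρ.2, Fintype.card_perm, h0]

/-- The average `(1 / m) ∑_i σ⁽ⁱ⁾` is the dual of symmetrization, applied to any `σ⁽ˡ⁾`. -/
theorem trace_localOp_mul_symmetrize (σ : LocOp n) (l : Fin m) (ρ : NetOp m n) :
    (localOp σ l * symmetrize ρ).trace =
      (((1 / (m : ℂ)) • ∑ i : Fin m, localOp σ i) * ρ).trace := by
  have h0 : (m.factorial : ℂ) ≠ 0 := by exact_mod_cast m.factorial_ne_zero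
  have hm : (m : ℂ) ≠ 0 := by
    have := l.pos
    exact_mod_cast this.ne'
  set f : Fin m → ℂ := fun i => (localOp σ i * ρ).trace with hf
  have h1 : ∀ l, (localOp σ l * symmetrize ρ).trace =
      (1 / (m.factorial : ℂ)) * ∑ π : Equiv.Perm (Fin m), f (π l) := by
    intro l
    rw [symmetrize_eq, Matrix.mul_smul, Matrix.trace_smul, Matrix.mul_sum, Matrix.trace_sum,
      smul_eq_mul]
    congr 1
    refine Finset.sum_congr rfl fun π _ => ?_
    rw [trace_mul_permConj, permConj_localOp, inv_inv]
  -- The group sum does not depend on the position, so `h3` evaluates it by averaging over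
  -- positions.
  have h2 : ∀ k, ∑ π : Equiv.Perm (Fin m), f (π k) = ∑ π : Equiv.Perm (Fin m), f (π l) := by
    intro k
    refine Fintype.sum_equiv (Equiv.mulRight (Equiv.swap k l)) _ _ fun π => ?_
    simp
  have h3 : (m : ℂ) * ∑ π : Equiv.Perm (Fin m), f (π l) = m.factorial * ∑ i, f i := by
    calc (m : ℂ) * ∑ π : Equiv.Perm (Fin m), f (π l)
        = ∑ k : Fin m, ∑ π : Equiv.Perm (Fin m), f (π k) := by
          rw [Finset.sum_congr rfl fun k _ => h2 k]; simp
      _ = ∑ π : Equiv.Perm (Fin m), ∑ k : Fin m, f (π k) := Finset.sum_comm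
      _ = m.factorial * ∑ i, f i := by
          rw [Finset.sum_congr rfl fun π _ => Equiv.sum_comp π f]
          simp [Fintype.card_perm]
  rw [h1, Matrix.smul_mul, Matrix.trace_smul, Matrix.sum_mul, Matrix.trace_sum, smul_eq_mul]
  field_simp
  linear_combination h3

/-- Operators are separated by their expectations on states. -/
theorem eq_of_trace_mul_state_eq {A B : NetOp m n}
    (h : ∀ ρ : NetOp m n, IsState ρ → (A * ρ).trace = (B * ρ).trace) : A = B := by
  rw [← sub_eq_zero]
  have hpsd : ∀ X : NetOp m n, X.PosSemidef → ((A - B) * X).trace = 0 := by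
    intro X hX
    by_cases h0 : X.trace = 0
    · rw [hX.trace_eq_zero_iff.1 h0]; simp
    · have hs : IsState (X.trace⁻¹ • X) :=
        ⟨hX.smul (inv_nonneg.2 hX.trace_nonneg), by
          rw [Matrix.trace_smul, smul_eq_mul, inv_mul_cancel₀ h0]⟩
      have := h _ hs
      rw [Matrix.mul_smul, Matrix.mul_smul, Matrix.trace_smul, Matrix.trace_smul] at this
      have := smul_right_injective ℂ (inv_ne_zero h0) this
      rw [sub_mul, Matrix.trace_sub, this, sub_self]
  -- Rank-one projectors give a vanishing quadratic form, which over ℂ forces the operator to vanish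
  -- by polarization.
  have hlin : Matrix.toEuclideanLin (A - B) = 0 := by
    rw [← inner_map_self_eq_zero]
    intro v
    have := hpsd _ (Matrix.posSemidef_vecMulVec_self_star v.ofLp)
    rw [Matrix.mul_vecMulVec, Matrix.trace_vecMulVec] at this
    have h1 : inner ℂ v (Matrix.toEuclideanLin (A - B) v) = 0 := by
      rw [EuclideanSpace.inner_eq_star_dotProduct]
      exact this
    rw [← inner_conj_symm, h1, map_zero]
  exact (LinearEquiv.map_eq_zero_iff _).1 hlin

end Symmetrization

/-! ### Convergence of gossip and average consensus. -/

section Consensus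

variable {m n : ℕ}

/-- Operators as vectors of a Euclidean space, with the Hilbert-Schmidt norm. -/
noncomputable def hilbertSchmidt (m n : ℕ) :
    NetOp m n ≃ₗ[ℂ] EuclideanSpace ℂ ((Fin m → Fin n) × (Fin m → Fin n)) :=
  (Matrix.ofLinearEquiv ℂ).symm ≪≫ₗ (LinearEquiv.curry ℂ ℂ _ _).symm ≪≫ₗ
    (WithLp.linearEquiv 2 ℂ _).symm

theorem hilbertSchmidt_apply (X : NetOp m n) (p : (Fin m → Fin n) × (Fin m → Fin n)) :
    hilbertSchmidt m n X p = X p.1 p.2 := rfl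

theorem norm_hilbertSchmidt_permConj (π : Equiv.Perm (Fin m)) (X : NetOp m n) :
    ‖hilbertSchmidt m n (permConj n π X)‖ = ‖hilbertSchmidt m n X‖ := by
  rw [EuclideanSpace.norm_eq, EuclideanSpace.norm_eq]
  congr 1
  refine Fintype.sum_equiv ((Equiv.arrowCongr π (Equiv.refl _)).prodCongr
    (Equiv.arrowCongr π (Equiv.refl _))) _ _ fun p => ?_
  rw [hilbertSchmidt_apply, permConj_apply_apply]
  rfl

theorem continuous_hilbertSchmidt_symm : Continuous (hilbertSchmidt m n).symm :=
  LinearMap.continuous_of_finiteDimensional (hilbertSchmidt m n).symm.toLinearMap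

theorem evolve_invariant {β : Type*} {E : ℕ → NetOp m n → NetOp m n} (f : NetOp m n → β)
    (hf : ∀ t X, f (E t X) = f X) (t : ℕ) (ρ : NetOp m n) : f (evolve E t ρ) = f ρ := by
  induction t with
  | zero => rfl
  | succ t ih => rw [evolve, hf, ih]

/-- Lazy contractions that preserve the symmetrization, and whose only common fixed points are the
symmetric operators, drive each operator to its symmetrization. -/
theorem tendsto_evolve_lazy {ι : Type*} [Finite ι] (R : ι → NetOp m n →ₗ[ℂ] NetOp m n)
    (hR : ∀ i X, ‖hilbertSchmidt m n (R i X)‖ ≤ ‖hilbertSchmidt m n X‖)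
    (hsym : ∀ i X, symmetrize (R i X) = symmetrize X)
    (hfix : ∀ X, (∀ i, R i X = X) → ∀ π, permConj n π X = X)
    {α : ℝ} (hα : α ∈ Set.Ioo (0 : ℝ) 1) (e : ℕ → ι) (he : ∀ i, ∃ᶠ t in atTop, e t = i)
    {E : ℕ → NetOp m n → NetOp m n}
    (hE : ∀ t X, E t X = (1 - (α : ℂ)) • X + (α : ℂ) • R (e t) X) (ρ : NetOp m n) :
    Tendsto (fun t => evolve E t ρ) atTop (𝓝 (symmetrize ρ)) := by
  obtain ⟨y, hy, hlim⟩ := exists_tendsto_of_lazy_contractions (𝕜 := ℂ)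
    (fun i => (hilbertSchmidt m n).toLinearMap ∘ₗ R i ∘ₗ (hilbertSchmidt m n).symm.toLinearMap)
    (fun i v => by simpa using hR i ((hilbertSchmidt m n).symm v)) hα e he
    (fun t => hilbertSchmidt m n (evolve E t ρ)) (fun t => by
      simp only [evolve, hE, map_add, map_smul]; simp)
  have hlim' : Tendsto (fun t => evolve E t ρ) atTop (𝓝 ((hilbertSchmidt m n).symm y)) := by
    simpa [Function.comp_def] using (continuous_hilbertSchmidt_symm.tendsto y).comp hlim
  have hinv : ∀ t X, symmetrize (E t X) = symmetrize X := fun t X => by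
    rw [hE, symmetrize_add, symmetrize_smul, symmetrize_smul, hsym]
    module
  have h1 : symmetrize ((hilbertSchmidt m n).symm y) = (hilbertSchmidt m n).symm y :=
    symmetrize_of_forall_permConj_eq (hfix _ fun i =>
      (hilbertSchmidt m n).injective (by simpa using hy i))
  have h2 := (continuous_symmetrize.tendsto _).comp hlim'
  simp only [Function.comp_def, evolve_invariant symmetrize hinv, h1] at h2
  -- The conserved quantity `symmetrize ρ` tends to the symmetrization of the limit, which is the
  -- limit itself.
  rwa [tendsto_nhds_unique tendsto_const_nhds h2]

/-- The stabilizer of `X` is closed under products. Chaining edge swaps along walks puts every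
transposition in it, and transpositions generate the symmetric group. -/
theorem permConj_eq_of_forall_swap {G : SimpleGraph (Fin m)} (hG : G.Connected) {X : NetOp m n}
    (h : ∀ a : G.edgeSet, permConj n (edgeSwap (a : Sym2 (Fin m))) X = X)
    (π : Equiv.Perm (Fin m)) : permConj n π X = X := by
  let H : Submonoid (Equiv.Perm (Fin m)) :=
    { carrier := {π | permConj n π X = X}
      one_mem' := permConj_one X
      mul_mem' := fun {a b} (ha : permConj n a X = X) (hb : permConj n b X = X) =>
        show permConj n (a * b) X = X by rw [permConj_mul, ha, hb] }
  have hwalk : ∀ j k, G.Reachable j k → Equiv.swap j k ∈ H := by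
    rintro j k ⟨w⟩
    induction w with
    | nil => rw [Equiv.swap_self]; exact H.one_mem
    | cons hadj _ ih => exact SubmonoidClass.swap_mem_trans H (h ⟨s(_, _), hadj⟩) ih
  have hle : Submonoid.closure {σ : Equiv.Perm (Fin m) | σ.IsSwap} ≤ H := by
    rw [Submonoid.closure_le]
    rintro _ ⟨j, k, -, rfl⟩
    exact hwalk j k (hG.preconnected j k)
  rw [Equiv.Perm.mclosure_isSwap] at hle
  exact hle (Submonoid.mem_top π)

theorem gossip_eq (α : ℝ) (a : Sym2 (Fin m)) (X : NetOp m n) :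
    gossip α a X = (1 - (α : ℂ)) • X + (α : ℂ) • permConj n (edgeSwap a) X := rfl

/-- Gossip along a sequence in which every edge of a connected graph occurs infinitely often. -/
theorem tendsto_evolve_gossip {G : SimpleGraph (Fin m)} (hG : G.Connected) {α : ℝ}
    (hα : α ∈ Set.Ioo (0 : ℝ) 1) (e : ℕ → G.edgeSet) (he : ∀ a, ∃ᶠ t in atTop, e t = a)
    (ρ : NetOp m n) :
    Tendsto (fun t => evolve (fun s => gossip α (e s : Sym2 (Fin m))) t ρ) atTop
      (𝓝 (symmetrize ρ)) := by
  have : Finite G.edgeSet := Subtype.finite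
  exact tendsto_evolve_lazy (fun a : G.edgeSet => permConj n (edgeSwap (a : Sym2 (Fin m))))
    (fun a X => (norm_hilbertSchmidt_permConj _ X).le) (fun a X => symmetrize_permConj _ X)
    (fun X hX => permConj_eq_of_forall_swap hG hX) hα e he (fun t X => gossip_eq _ _ _) ρ

/-- The mean channel is the lazy version of the q-average of the swap conjugations. By strict
convexity, a fixed point of this average is fixed by each conjugation. -/
theorem tendsto_evolve_meanGossip {G : SimpleGraph (Fin m)} [DecidableRel G.Adj]
    (hG : G.Connected) {α : ℝ} (hα : α ∈ Set.Ioo (0 : ℝ) 1) {q : G.edgeSet → ℝ}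
    (hq : ∀ a, 0 < q a) (hq1 : ∑ a, q a = 1) (ρ : NetOp m n) :
    Tendsto (fun t => evolve (fun _ => meanGossip G α q) t ρ) atTop (𝓝 (symmetrize ρ)) := by
  have hq1' : ∑ a, (q a : ℂ) = 1 := by exact_mod_cast hq1
  refine tendsto_evolve_lazy (ι := Unit) (fun _ => ∑ a : G.edgeSet,
    (q a : ℂ) • permConj n (edgeSwap (a : Sym2 (Fin m)))) (fun _ X => ?_) (fun _ X => ?_)
    (fun X hX => ?_) hα (fun _ => ()) (fun _ => Frequently.of_forall fun _ => rfl)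
    (fun _ X => ?_) ρ
  · simp only [LinearMap.sum_apply, LinearMap.smul_apply, map_sum, map_smul]
    refine (norm_sum_le _ _).trans_eq ?_
    simp only [norm_smul, norm_hilbertSchmidt_permConj, ← Finset.sum_mul, Complex.norm_real,
      Real.norm_eq_abs, abs_of_pos (hq _), hq1, one_mul]
  · simp only [LinearMap.sum_apply, LinearMap.smul_apply, symmetrize_sum, symmetrize_smul,
      symmetrize_permConj, ← Finset.sum_smul, hq1', one_smul]
  · refine permConj_eq_of_forall_swap hG fun a => (hilbertSchmidt m n).injective ?_
    refine eq_of_sum_smul_eq_of_norm_le (𝕜 := ℂ) hq hq1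
      (w := fun a : G.edgeSet =>
        hilbertSchmidt m n (permConj n (edgeSwap (a : Sym2 (Fin m))) X))
      (fun a => (norm_hilbertSchmidt_permConj _ X).le) ?_ a
    have h := congrArg (hilbertSchmidt m n) (hX ())
    simp only [LinearMap.sum_apply, LinearMap.smul_apply, map_sum, map_smul] at h
    exact h
  · simp only [meanGossip, gossip_eq, LinearMap.sum_apply, LinearMap.smul_apply, smul_add,
      Finset.sum_add_distrib, ← Finset.sum_smul, hq1', one_smul, Finset.smul_sum,
      smul_comm (α : ℂ)]

theorem continuous_seminorm_netOp (N : Seminorm ℂ (NetOp m n)) : Continuous N := by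
  refine Seminorm.continuous_of_continuousAt_zero ?_
  have hle : ∀ X : NetOp m n, N X ≤ ∑ x, ∑ y, ‖X x y‖ * N (Matrix.single x y 1) := by
    intro X
    conv_lhs => rw [Matrix.matrix_eq_sum_single X]
    refine (Finset.le_sum_of_subadditive N (map_zero N).le (map_add_le_add N) _ _).trans (Finset.sum_le_sum fun x _ => ?_)
    refine (Finset.le_sum_of_subadditive N (map_zero N).le (map_add_le_add N) _ _).trans (Finset.sum_le_sum fun y _ => ?_)
    rw [← map_smul_eq_mul, Matrix.smul_single, smul_eq_mul, mul_one]
  have hc : Continuous fun X : NetOp m n => ∑ x, ∑ y, ‖X x y‖ * N (Matrix.single x y 1) := by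
    refine continuous_finsetSum _ fun x _ => continuous_finsetSum _ fun y _ => ?_
    exact (continuous_id.matrix_elem x y).norm.mul continuous_const
  have h0 := hc.tendsto 0
  simp only [Matrix.zero_apply, norm_zero, zero_mul, Finset.sum_const_zero] at h0
  rw [ContinuousAt, map_zero]
  exact squeeze_zero (fun X => apply_nonneg N X) hle h0

/-- The limit is itself a symmetric state, so it bounds the infimum from above. -/
theorem achievesSSC_of_tendsto {E : ℕ → NetOp m n → NetOp m n}
    (h : ∀ ρ, IsState ρ → Tendsto (fun t => evolve E t ρ) atTop (𝓝 (symmetrize ρ))) :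
    AchievesSSC E := by
  intro N _ ρ hρ
  have h0 : Tendsto (fun t => N (evolve E t ρ - symmetrize ρ)) atTop (𝓝 0) := by
    have := ((continuous_seminorm_netOp N).tendsto _).comp ((h ρ hρ).sub_const (symmetrize ρ))
    simpa [Function.comp_def] using this
  refine squeeze_zero (fun t => Real.sInf_nonneg ?_) (fun t => csInf_le ⟨0, ?_⟩ ?_) h0
  · rintro _ ⟨τ, _, rfl⟩
    exact apply_nonneg N _
  · rintro _ ⟨τ, _, rfl⟩
    exact apply_nonneg N _
  · exact ⟨_, symmetrize_mem_SSC hρ, rfl⟩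

theorem achievesAverageSSC_iff {E : ℕ → NetOp m n → NetOp m n} (hm : 0 < m)
    (h : ∀ ρ, IsState ρ → Tendsto (fun t => evolve E t ρ) atTop (𝓝 (symmetrize ρ)))
    (S : NetOp m n) : AchievesAverageSSC E S ↔ IsLocalAverage S := by
  have htr : ∀ A ρ : NetOp m n, IsState ρ →
      Tendsto (fun t => (A * evolve E t ρ).trace) atTop (𝓝 (A * symmetrize ρ).trace) := by
    intro A ρ hρ
    have hc : Continuous fun X : NetOp m n => (A * X).trace :=
      (continuous_const.matrix_mul continuous_id).matrix_trace
    exact (hc.tendsto _).comp (h ρ hρ)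
  constructor
  · rintro ⟨-, σ, hσ, hlim⟩
    refine ⟨σ, hσ, eq_of_trace_mul_state_eq fun ρ hρ => ?_⟩
    rw [← trace_localOp_mul_symmetrize σ ⟨0, hm⟩]
    exact tendsto_nhds_unique (hlim ρ hρ ⟨0, hm⟩).2.1 (htr _ ρ hρ)
  · rintro ⟨σ, hσ, rfl⟩
    refine ⟨achievesSSC_of_tendsto h, σ, hσ, fun ρ hρ l => ?_⟩
    have hl := htr (localOp σ l) ρ hρ
    rw [trace_localOp_mul_symmetrize] at hl
    simp only [trace_mul_reducedState]
    refine ⟨hl, hl, ?_⟩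
    have hS := htr ((1 / (m : ℂ)) • ∑ i : Fin m, localOp σ i) ρ hρ
    -- By duality Tr(Sρ_*) is Tr(σ⁽ˡ⁾ ·) at the symmetrization of ρ_*, which is ρ_*; duality again
    -- returns Tr(Sρ).
    rwa [← trace_localOp_mul_symmetrize σ l, symmetrize_of_forall_permConj_eq
      (fun π => permConj_symmetrize π ρ), trace_localOp_mul_symmetrize] at hS

theorem frequently_eq_of_isCyclicSelection {G : SimpleGraph (Fin m)} {e : ℕ → G.edgeSet}
    (he : IsCyclicSelection e) (a : G.edgeSet) : ∃ᶠ t in atTop, e t = a := by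
  obtain ⟨⟨T, hT, hper⟩, hsurj⟩ := he
  obtain ⟨t, rfl⟩ := hsurj a
  refine frequently_atTop.2 fun k => ⟨t + k * T, ?_, ?_⟩
  · nlinarith
  · simpa using hper.nat_mul k t

end Consensus

/-! ### Independent draws from a finite set. -/

section RandomSelection

variable {m n : ℕ}

theorem evolve_congr {E E' : ℕ → NetOp m n → NetOp m n} {t : ℕ} (h : ∀ s < t, E s = E' s)
    (ρ : NetOp m n) : evolve E t ρ = evolve E' t ρ := by
  induction t with
  | zero => rfl
  | succ t ih =>
    rw [evolve, evolve, ih fun s hs => h s (hs.trans t.lt_succ_self), h t t.lt_succ_self]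

/-- The state at time `t` is a function of the choices made before the time `t`. -/
theorem exists_evolve_eq_comp {β : Type*} (K : β → NetOp m n → NetOp m n) (t : ℕ)
    (ρ : NetOp m n) : ∃ F : (Finset.range t → β) → NetOp m n,
      ∀ e : ℕ → β, evolve (fun s => K (e s)) t ρ = F fun i => e i := by
  classical
  -- The default `id` is never reached before time `t`.
  refine ⟨fun w => evolve (fun s => if h : s ∈ Finset.range t then K (w ⟨s, h⟩) else id) t ρ,
    fun e => evolve_congr (fun s hs => ?_) ρ⟩
  rw [dif_pos (Finset.mem_range.2 hs)]

theorem measurable_past {Ω β : Type*} [MeasurableSpace Ω] [MeasurableSpace β] {e : ℕ → Ω → β}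
    (hm : ∀ t, Measurable (e t)) (t : ℕ) :
    Measurable fun ω => fun i : Finset.range t => e i ω :=
  measurable_pi_lambda _ fun i => hm i

variable {Ω β : Type*} [MeasurableSpace Ω] {P : Measure Ω} [MeasurableSpace β]
  [DiscreteMeasurableSpace β] [Finite β]

/-- The indicator of the choice at time `t` is independent of functions of the past. -/
theorem integral_indicator_mul_of_past {e : ℕ → Ω → β} (hm : ∀ t, Measurable (e t))
    (hi : iIndepFun e P) (t : ℕ) (a : β) [DecidableEq β] (F : (Finset.range t → β) → ℂ) :
    ∫ ω, (if e t ω = a then 1 else 0) * F (fun i => e i ω) ∂P =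
      (P.real {ω | e t ω = a} : ℂ) * ∫ ω, F (fun i => e i ω) ∂P := by
  have hind := (hi.indepFun_finset {t} (Finset.range t) (by simp) hm).comp
    (φ := fun w => w ⟨t, Finset.mem_singleton_self t⟩) (ψ := id)
    Measurable.of_discrete measurable_id
  have hpast := measurable_past hm t
  have h := hind.integral_fun_comp_mul_comp (𝕜 := ℂ) (f := fun b => if b = a then 1 else 0)
    (g := F) (hm t).aemeasurable hpast.aemeasurable
    (Measurable.of_discrete).aestronglyMeasurable (Measurable.of_discrete).aestronglyMeasurable
  refine h.trans ?_
  congr 1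
  have hs : MeasurableSet {ω | e t ω = a} := hm t (measurableSet_singleton a)
  rw [← integral_indicator_one hs, ← integral_complex_ofReal]
  refine integral_congr_ae (Eventually.of_forall fun ω => ?_)
  by_cases hω : e t ω = a <;> simp [hω]

variable [IsProbabilityMeasure P]

theorem integrable_comp_of_finite {𝕜 : Type*} [RCLike 𝕜] {X : Ω → β} (hX : Measurable X)
    (f : β → 𝕜) : Integrable (fun ω => f (X ω)) P := by
  have := Measure.isProbabilityMeasure_map (μ := P) hX.aemeasurable
  exact Integrable.comp_measurable (g := f) Integrable.of_finite hX

/-- A value of positive probability is taken infinitely often by independent draws. -/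
theorem ae_frequently_eq {e : ℕ → Ω → β} (hm : ∀ t, Measurable (e t)) (hi : iIndepFun e P)
    {a : β} {c : ENNReal} (hc : c ≠ 0) (h : ∀ t, P {ω | e t ω = a} = c) :
    ∀ᵐ ω ∂P, ∃ᶠ t in atTop, e t ω = a := by
  have hs : ∀ t, MeasurableSet {ω | e t ω = a} := fun t => hm t (measurableSet_singleton a)
  have hind : iIndepSet (fun t => {ω | e t ω = a}) P :=
    (iIndepSet_iff_meas_biInter hs).2 fun s =>
      hi.measure_inter_preimage_eq_mul s (sets := fun _ => {a})
        fun _ _ => measurableSet_singleton a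
  -- Second Borel-Cantelli lemma: the probabilities are a nonzero constant, so their sum diverges.
  have h1 := measure_limsup_eq_one hs hind (by
    simp only [h]
    exact ENNReal.tsum_const_eq_top_of_ne_zero hc)
  have h2 := (mem_ae_iff_prob_eq_one (MeasurableSet.measurableSet_limsup hs)).2 h1
  filter_upwards [h2] with ω hω
  exact (mem_limsup_iff_frequently_mem (s := fun t => {ω | e t ω = a})).1 hω

end RandomSelection

/-! ### Gossip along random edges. -/

section RandomGossip

variable {m n : ℕ}

theorem gossip_apply (α : ℝ) (a : Sym2 (Fin m)) (X : NetOp m n) (x y : Fin m → Fin n) :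
    gossip α a X x y = (1 - (α : ℂ)) * X x y +
      (α : ℂ) * X (x ∘ (edgeSwap a).symm) (y ∘ (edgeSwap a).symm) := by
  rw [gossip_eq, Matrix.add_apply, Matrix.smul_apply, Matrix.smul_apply, permConj_apply_apply]
  rfl

theorem expectedOp_gossip {Ω : Type*} [MeasurableSpace Ω] {P : Measure Ω} {α : ℝ} (a : Sym2 (Fin m)) {ρ : Ω → NetOp m n}
    (hρ : ∀ x y, Integrable (fun ω => ρ ω x y) P) :
    expectedOp P (fun ω => gossip α a (ρ ω)) = gossip α a (expectedOp P ρ) := by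
  ext x y
  simp only [expectedOp, gossip_apply, Matrix.of_apply]
  rw [integral_add ((hρ _ _).const_mul _) ((hρ _ _).const_mul _), integral_const_mul,
    integral_const_mul]

variable {G : SimpleGraph (Fin m)} {q : G.edgeSet → ℝ} {Ω : Type*}
  [MeasurableSpace Ω] {P : Measure Ω} [IsProbabilityMeasure P] {e : ℕ → Ω → G.edgeSet}

/-- The edge drawn at time t is independent of the current state. Splitting over its value, the
expectation of the next step factors, and linearity of the channels yields the mean channel.
Integrability is automatic, since the past takes finitely many values. -/
theorem expectedOp_evolve_gossip [DecidableRel G.Adj] (hq : ∀ a, 0 ≤ q a)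
    (he : IsRandomSelection q P e) (α : ℝ) (ρ : NetOp m n) (t : ℕ) :
    expectedOp P (fun ω => evolve (fun s => gossip α (e s ω : Sym2 (Fin m))) t ρ) =
      evolve (fun _ => meanGossip G α q) t ρ := by
  classical
  let _ : MeasurableSpace G.edgeSet := ⊤
  induction t with
  | zero =>
    ext x y
    simp [expectedOp, evolve]
  | succ t ih =>
    obtain ⟨F, hF⟩ := exists_evolve_eq_comp
      (fun a : G.edgeSet => gossip (n := n) α (a : Sym2 (Fin m))) t ρ
    have hpast := measurable_past he.measurable t
    have hint : ∀ f : (Finset.range t → G.edgeSet) → ℂ,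
        Integrable (fun ω => f fun i => e i ω) P := integrable_comp_of_finite hpast
    simp only [evolve] at ih ⊢
    rw [← ih, meanGossip]
    simp only [fun ω => hF fun s => e s ω]
    have hlaw : ∀ a, P.real {ω | e t ω = a} = q a := fun a => by
      rw [measureReal_def, he.law, ENNReal.toReal_ofReal (hq a)]
    ext x y
    have hsplit : ∀ ω, gossip α (e t ω : Sym2 (Fin m)) (F fun i => e i ω) x y =
        ∑ a : G.edgeSet, (if e t ω = a then 1 else 0) *
          gossip α (a : Sym2 (Fin m)) (F fun i => e i ω) x y := fun ω => by simp
    simp only [expectedOp, Matrix.of_apply, hsplit]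
    rw [integral_finsetSum]
    · rw [Matrix.sum_apply]
      refine Finset.sum_congr rfl fun a _ => ?_
      rw [integral_indicator_mul_of_past he.measurable he.indep t a
        (fun w => gossip α (a : Sym2 (Fin m)) (F w) x y), hlaw, Matrix.smul_apply, smul_eq_mul]
      congr 1
      exact congrFun (congrFun (expectedOp_gossip (a : Sym2 (Fin m))
        (fun u v => hint fun w => F w u v)) x) y
    · intro a _
      exact (integrable_comp_of_finite (measurable_past he.measurable _)
        fun w : Finset.range (t + 1) → G.edgeSet =>
          (if w ⟨t, Finset.self_mem_range_succ t⟩ = a then (1 : ℂ) else 0) *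
            gossip α (a : Sym2 (Fin m))
              (F fun i => w ⟨i, Finset.mem_range.2
                ((Finset.mem_range.1 i.2).trans t.lt_succ_self)⟩) x y)

/-- The null set depends on neither the initial state nor the observable, so the deterministic
results hold for all of them at once. -/
theorem ae_forall_frequently_eq (hq : ∀ a, 0 < q a) (he : IsRandomSelection q P e) :
    ∀ᵐ ω ∂P, ∀ a, ∃ᶠ t in atTop, e t ω = a := by
  let _ : MeasurableSpace G.edgeSet := ⊤
  have : Finite G.edgeSet := Subtype.finite
  exact ae_all_iff.2 fun a => ae_frequently_eq he.measurable he.indep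
    (ENNReal.ofReal_pos.2 (hq a)).ne' fun t => he.law t a

/-- Almost sure convergence of the trajectories implies convergence in probability. -/
theorem exists_prob_lt_of_ae_tendsto (he : IsRandomSelection q P e) {α : ℝ} {ρ τ : NetOp m n}
    (h : ∀ᵐ ω ∂P, Tendsto (fun t => evolve (fun s => gossip α (e s ω : Sym2 (Fin m))) t ρ) atTop
      (𝓝 τ)) {δ ε : ℝ} (hδ : 0 < δ) (hε : 0 < ε) :
    ∃ T : ℕ, 0 < T ∧
      P {ω | ε < (((evolve (fun s => gossip α (e s ω : Sym2 (Fin m))) T ρ - τ) ^ 2).trace).re} <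
        ENNReal.ofReal δ := by
  let _ : MeasurableSpace G.edgeSet := ⊤
  have : Finite G.edgeSet := Subtype.finite
  set f : ℕ → Ω → ℝ := fun t ω =>
    (((evolve (fun s => gossip α (e s ω : Sym2 (Fin m))) t ρ - τ) ^ 2).trace).re with hf
  have hmeas : ∀ t, AEStronglyMeasurable (f t) P := fun t => by
    obtain ⟨F, hF⟩ := exists_evolve_eq_comp
      (fun a : G.edgeSet => gossip (n := n) α (a : Sym2 (Fin m))) t ρ
    simp only [hf, fun ω => hF fun s => e s ω]
    exact (integrable_comp_of_finite (measurable_past he.measurable _)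
      fun w : Finset.range t → G.edgeSet => (((F w - τ) ^ 2).trace).re).aestronglyMeasurable
  have hlim : ∀ᵐ ω ∂P, Tendsto (fun t => f t ω) atTop (𝓝 0) := by
    filter_upwards [h] with ω hω
    have hc : Continuous fun X : NetOp m n => (((X - τ) * (X - τ)).trace).re :=
      Complex.continuous_re.comp (((continuous_id.sub continuous_const).matrix_mul
        (continuous_id.sub continuous_const)).matrix_trace)
    have := (hc.tendsto τ).comp hω
    simpa [hf, sq, Function.comp_def] using this
  have hT := tendstoInMeasure_iff_norm.1 (tendstoInMeasure_of_tendsto_ae hmeas hlim) ε hε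
  obtain ⟨T, hT, hpos⟩ := ((hT.eventually (gt_mem_nhds (ENNReal.ofReal_pos.2 hδ))).and
    (eventually_gt_atTop 0)).exists
  refine ⟨T, hpos, (measure_mono fun ω hω => ?_).trans_lt hT⟩
  rw [Set.mem_ofPred_eq, sub_zero]
  exact (le_of_lt hω).trans (Real.le_norm_self _)

end RandomGossip

/-! ### The consensus theorem. -/

theorem mainTheorem1 {m n : ℕ} (hn : 2 ≤ n) (G : SimpleGraph (Fin m)) [DecidableRel G.Adj]
    (hG : G.Connected) (α : ℝ) (hα : α ∈ Set.Ioo (0 : ℝ) 1) :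
    -- the symmetrized state is a state in symmetric-state consensus
    (∀ ρ₀ : NetOp m n, IsState ρ₀ → symmetrize ρ₀ ∈ SSC m n) ∧
    -- cyclic selection
    (∀ e : ℕ → G.edgeSet, IsCyclicSelection e →
      AchievesSSC (n := n) (fun t => gossip α (e t : Sym2 (Fin m))) ∧
      (∀ ρ₀ : NetOp m n, IsState ρ₀ →
        Tendsto (fun t => evolve (fun s => gossip α (e s : Sym2 (Fin m))) t ρ₀) atTop
          (𝓝 (symmetrize ρ₀))) ∧
      (∀ S : NetOp m n, S.IsHermitian →
        (AchievesAverageSSC (fun t => gossip α (e t : Sym2 (Fin m))) S ↔ IsLocalAverage S))) ∧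
    (∀ q : G.edgeSet → ℝ, (∀ a, 0 < q a) → ∑ a, q a = 1 →
      -- random selection, in expectation
      (AchievesSSC (n := n) (fun _ => meanGossip G α q) ∧
        (∀ ρ₀ : NetOp m n, IsState ρ₀ →
          Tendsto (fun t => evolve (fun _ => meanGossip G α q) t ρ₀) atTop
            (𝓝 (symmetrize ρ₀))) ∧
        (∀ S : NetOp m n, S.IsHermitian →
          (AchievesAverageSSC (fun _ => meanGossip G α q) S ↔ IsLocalAverage S))) ∧
      ∀ (Ω : Type*) [MeasurableSpace Ω] (P : Measure Ω) [IsProbabilityMeasure P]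
        (e : ℕ → Ω → G.edgeSet), IsRandomSelection q P e →
        (∀ ρ₀ : NetOp m n, IsState ρ₀ →
          (∀ t, expectedOp P
              (fun ω => evolve (fun s => gossip α (e s ω : Sym2 (Fin m))) t ρ₀) =
            evolve (fun _ => meanGossip G α q) t ρ₀) ∧
          Tendsto (fun t => expectedOp P
            (fun ω => evolve (fun s => gossip α (e s ω : Sym2 (Fin m))) t ρ₀)) atTop
            (𝓝 (symmetrize ρ₀))) ∧
        -- random selection, with probability one on trajectories
        (∀ᵐ ω ∂P,
          AchievesSSC (n := n) (fun t => gossip α (e t ω : Sym2 (Fin m))) ∧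
          (∀ ρ₀ : NetOp m n, IsState ρ₀ →
            Tendsto (fun t => evolve (fun s => gossip α (e s ω : Sym2 (Fin m))) t ρ₀) atTop
              (𝓝 (symmetrize ρ₀))) ∧
          (∀ S : NetOp m n, S.IsHermitian →
            (AchievesAverageSSC (fun t => gossip α (e t ω : Sym2 (Fin m))) S ↔
              IsLocalAverage S))) ∧
        (∀ ρ₀ : NetOp m n, IsState ρ₀ → ∀ δ ε : ℝ, 0 < δ → 0 < ε → ∃ T : ℕ, 0 < T ∧
          P {ω | ε < (((evolve (fun s => gossip α (e s ω : Sym2 (Fin m))) T ρ₀ -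
            symmetrize ρ₀) ^ 2).trace).re} < ENNReal.ofReal δ)) := by
  have hm : 0 < m := Fin.pos_iff_nonempty.2 hG.nonempty
  refine ⟨fun ρ hρ => symmetrize_mem_SSC hρ, fun e he => ?_, fun q hq hq1 => ⟨?_, ?_⟩⟩
  · have h := tendsto_evolve_gossip (n := n) hG hα e (frequently_eq_of_isCyclicSelection he)
    exact ⟨achievesSSC_of_tendsto fun ρ _ => h ρ, fun ρ _ => h ρ,
      fun S _ => achievesAverageSSC_iff hm (fun ρ _ => h ρ) S⟩
  · have h := tendsto_evolve_meanGossip (n := n) hG hα hq hq1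
    exact ⟨achievesSSC_of_tendsto fun ρ _ => h ρ, fun ρ _ => h ρ,
      fun S _ => achievesAverageSSC_iff hm (fun ρ _ => h ρ) S⟩
  · intro Ω _ P _ e he
    have hlim : ∀ᵐ ω ∂P, ∀ ρ : NetOp m n,
        Tendsto (fun t => evolve (fun s => gossip α (e s ω : Sym2 (Fin m))) t ρ) atTop
          (𝓝 (symmetrize ρ)) := by
      filter_upwards [ae_forall_frequently_eq hq he] with ω hω
      exact tendsto_evolve_gossip hG hα _ hω
    refine ⟨fun ρ _ => ?_, ?_, fun ρ _ δ ε hδ hε => ?_⟩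
    · have hE := expectedOp_evolve_gossip (fun a => (hq a).le) he α ρ
      refine ⟨hE, ?_⟩
      simp only [hE]
      exact tendsto_evolve_meanGossip hG hα hq hq1 ρ
    · filter_upwards [hlim] with ω h
      exact ⟨achievesSSC_of_tendsto fun ρ _ => h ρ, fun ρ _ => h ρ,
        fun S _ => achievesAverageSSC_iff hm (fun ρ _ => h ρ) S⟩
    · exact exists_prob_lt_of_ae_tendsto he (hlim.mono fun ω h => h ρ) hδ hε
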